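/- **Theorem.** A *polyhedron* in $\mathbb R^D$ is an intersection of finitely many closed halfspaces $\{x : \langle a,x\rangle\le b\}$, $a\ne0$. The *faces* of a polyhedron $P$ are $P$, $\emptyset$, and the sets $P\cap H$ where $H$ is a closed halfspace whose boundary is disjoint from the relative interior of $P$. The dimension of a nonempty face is the dimension of its affine hull, and $\dim\emptyset=-1$. For an affine function $\ell:\mathbb R^D\to\mathbb R$ and $B\in\mathbb R$, let $P^{\ell<B}$ be the complex of all faces of $P$ at every point of which $\ell<B$; let $P^{\ell<\infty}$ be the complex of all faces of $P$ on which $\ell$ is bounded (above and below). Let $\dim P^{\ell<B}$ be the maximum dimension of a face in $P^{\ell<B}$. For every integer $d$ there is a constant $C=C(d)$, depending only on $d$, such that the following holds for all $D\ge 0$ and $n\ge1$. Let $P$ be the intersection of $n$ closed halfspaces in $\mathbb R^D$ (repetitions allowed), let $\ell$ be an affine function that attains a minimum on $P$, let $B\in\mathbb R\cup\{\infty\}$, and suppose that $\dim P^{\ell<B}=d<D$. Then $P^{\ell<B}$ has finitely many faces, and their number, counting the empty face, is at most $C\,n^{d^2}$; that is, it is $O(n^{d^2})$ with a constant independent of $D$,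 $P$, $\ell$ and $B$. -/

import Mathlib

/-- A closed halfspace of `ℝ^D`: the solution set of one nontrivial linear inequality. -/
def IsClosedHalfspace {D : ℕ} (H : Set (EuclideanSpace ℝ (Fin D))) : Prop :=
  ∃ a : EuclideanSpace ℝ (Fin D), a ≠ 0 ∧ ∃ b : ℝ, H = {x | inner ℝ a x ≤ b}

/-- `F` is a face of the polyhedron `P`: it is `P ∩ H` for a closed halfspace `H` whose boundary
is disjoint from the relative interior of `P`. By convention `P` and `∅` are always faces (this
is automatic unless `P` is the whole space). -/
def IsPolyhedronFace {D : ℕ} (P F : Set (EuclideanSpace ℝ (Fin D))) : Prop :=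
  F = P ∨ F = ∅ ∨
    ∃ H : Set (EuclideanSpace ℝ (Fin D)), IsClosedHalfspace H ∧
      Disjoint (frontier H) (intrinsicInterior ℝ P) ∧ F = P ∩ H

open Classical in
/-- The dimension of a set is the dimension of its affine hull; the empty set has
dimension `-1`. -/
noncomputable def faceDim {D : ℕ} (F : Set (EuclideanSpace ℝ (Fin D))) : ℤ :=
  if F = ∅ then -1 else (Module.finrank ℝ (affineSpan ℝ F).direction : ℤ)

/-- The complex `P^{ℓ<B}`. For real `B` it is the set of faces of `P` at all of whose points
`ℓ < B`; for `B = ∞` it is the set of faces of `P` on which `ℓ` is bounded. -/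
def sublevelComplex {D : ℕ} (P : Set (EuclideanSpace ℝ (Fin D)))
    (ℓ : EuclideanSpace ℝ (Fin D) →ᵃ[ℝ] ℝ) :
    WithTop ℝ → Set (Set (EuclideanSpace ℝ (Fin D)))
  | (B : ℝ) => {F | IsPolyhedronFace P F ∧ ∀ x ∈ F, ℓ x < B}
  | ⊤ => {F | IsPolyhedronFace P F ∧ BddAbove (ℓ '' F) ∧ BddBelow (ℓ '' F)}

/-- `P^{ℓ<B}` has dimension `d`: the maximum of the dimensions of its faces is `d`. -/
def SublevelComplexHasDim {D : ℕ} (P : Set (EuclideanSpace ℝ (Fin D)))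
    (ℓ : EuclideanSpace ℝ (Fin D) →ᵃ[ℝ] ℝ) (B : WithTop ℝ) (d : ℤ) : Prop :=
  IsGreatest (faceDim '' sublevelComplex P ℓ B) d

/-! Place the polyhedron at height one of a cone with m = n + 1 constraints. Let `f` be the height
and `l` the homogenization of `ℓ - B`. Faces become sets of tight constraints, and the faces to
count meet `f > 0` and have `l ≤ 0`. On each of them `l / f` attains its maximum at a vertex y
(modulo lineality), and the faces are counted by grouping them according to y.

Few vertices occur. In the tangent cone at y, `exists_face_and_constraints`, applied to `l - f • l
y` with a lexicographic tie-break, gives a face where the functional is nonpositive and a set `I` of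
constraints whose tightening makes it nonnegative. The size of `I` is at most the dimension of that
face modulo the lineality space of the tangent cone. The face belongs to the complex, so `I` has at
most r elements when the faces have dimension at most r + 1 modulo lineality. As y minimizes the
refined objective once `I` is tight, `I` determines the active set of y, which leaves at most (r +
1) m^r possibilities.

The faces with maximum at y are the minimal face at y and faces in the analogous complex of the
tangent cone. The lineality space has grown there, so the relative dimension drops by one. Hence N(r
+ 1) ≤ (r + 1) m^r (1 + N(r)) with N(0) = 0, and N(d + 1) = O(m^{d²}). -/

/-! ### Polyhedral cones, vertices and tangent cones -/

section Cones

open Filter Topology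

variable {V ι E : Type*} [AddCommGroup V] [Module ℝ V]

/-- The cone of all `x` with `a i x ≤ 0` for `i ∈ T`. -/
def ineqCone (a : ι → V →ₗ[ℝ] ℝ) (T : Finset ι) : Set V := {x | ∀ i ∈ T, a i x ≤ 0}

/-- The lineality space of `ineqCone a T`. -/
def linealitySpace (a : ι → V →ₗ[ℝ] ℝ) (T : Finset ι) : Submodule ℝ V where
  carrier := {x | ∀ i ∈ T, a i x = 0}
  add_mem' hx hy i hi := by simp [hx i hi, hy i hi]
  zero_mem' i _ := by simp
  smul_mem' c x hx i hi := by simp [hx i hi]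

open Classical in
/-- The constraints in `T` that are tight at `x`. -/
noncomputable def activeSet (a : ι → V →ₗ[ℝ] ℝ) (T : Finset ι) (x : V) : Finset ι :=
  T.filter fun i => a i x = 0

variable {a : ι → V →ₗ[ℝ] ℝ} {S T : Finset ι} {x y z w u : V}

theorem mem_activeSet {i : ι} : i ∈ activeSet a T x ↔ i ∈ T ∧ a i x = 0 := by
  simp [activeSet]

theorem activeSet_subset : activeSet a T x ⊆ T := Finset.filter_subset _ _

theorem mem_linealitySpace : x ∈ linealitySpace a T ↔ ∀ i ∈ T, a i x = 0 := Iff.rfl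

theorem linealitySpace_anti (h : S ⊆ T) : linealitySpace a T ≤ linealitySpace a S :=
  fun _ hx i hi => hx i (h hi)

theorem mem_linealitySpace_activeSet : x ∈ linealitySpace a (activeSet a T x) :=
  fun _ hi => (mem_activeSet.1 hi).2

theorem ineqCone_anti (h : S ⊆ T) : ineqCone a T ⊆ ineqCone a S :=
  fun _ hx i hi => hx i (h hi)

theorem linealitySpace_subset_ineqCone (hx : x ∈ linealitySpace a T) : x ∈ ineqCone a T :=
  fun i hi => (hx i hi).le

theorem smul_mem_ineqCone {c : ℝ} (hc : 0 ≤ c) (hx : x ∈ ineqCone a T) : c • x ∈ ineqCone a T :=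
  fun i hi => by
    simpa using mul_nonpos_of_nonneg_of_nonpos hc (hx i hi)

theorem subset_activeSet (hS : S ⊆ T) (hx : x ∈ linealitySpace a S) : S ⊆ activeSet a T x :=
  fun i hi => mem_activeSet.2 ⟨hS hi, hx i hi⟩

/-- Leaving a cone along a direction tangent to the active face makes a new constraint tight. -/
theorem exists_exit (hw : w ∈ ineqCone a T) (hu : u ∈ linealitySpace a (activeSet a T w))
    (hj : ∃ j ∈ T, 0 < a j u) :
    ∃ t : ℝ, 0 ≤ t ∧ w + t • u ∈ ineqCone a T ∧ activeSet a T w ⊂ activeSet a T (w + t • u) := by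
  classical
  obtain ⟨j, hjT, hju⟩ := hj
  -- Ratio test: `k` is the first constraint to become tight along the ray.
  obtain ⟨k, hk, hmin⟩ := Finset.exists_min_image (T.filter fun i => 0 < a i u)
    (fun i => -a i w / a i u) ⟨j, by simp [hjT, hju]⟩
  simp only [Finset.mem_filter] at hk hmin
  have ht : 0 ≤ -a k w / a k u := div_nonneg (by linarith [hw k hk.1]) hk.2.le
  refine ⟨-a k w / a k u, ht, fun i hi => ?_, ?_⟩
  · simp only [map_add, map_smul, smul_eq_mul]
    rcases le_or_gt (a i u) 0 with h | h
    · nlinarith [hw i hi]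
    · have := hmin i ⟨hi, h⟩
      rw [le_div_iff₀ h] at this
      linarith
  · refine Finset.ssubset_iff_of_subset (fun i hi => ?_) |>.2 ⟨k, ?_, ?_⟩
    · rw [mem_activeSet] at hi ⊢
      exact ⟨hi.1, by simp [hi.2, hu i (mem_activeSet.2 hi)]⟩
    · rw [mem_activeSet]
      refine ⟨hk.1, ?_⟩
      have := hk.2.ne'
      simp
      field_simp
      ring
    · intro h
      exact hk.2.ne' (hu k h)

/-- Near `y`, the cone agrees with its tangent cone at `y`. -/
theorem eventually_tangentCone (hy : y ∈ ineqCone a T) (hz : z ∈ ineqCone a (activeSet a T y)) :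
    ∀ᶠ ε in 𝓝[>] (0 : ℝ), y + ε • z ∈ ineqCone a T ∧
      activeSet a T (y + ε • z) = activeSet a (activeSet a T y) z := by
  have key : ∀ᶠ ε in 𝓝[>] (0 : ℝ), ∀ i ∈ T, a i y < 0 → a i y + ε * a i z < 0 := by
    rw [Filter.eventually_all_finset]
    intro i _
    rcases lt_or_ge (a i y) 0 with h | h
    · have hc : Tendsto (fun ε : ℝ => a i y + ε * a i z) (𝓝[>] 0) (𝓝 (a i y + 0 * a i z)) :=
        (Continuous.tendsto (by fun_prop) 0).mono_left nhdsWithin_le_nhds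
      have := hc.eventually_lt_const (show a i y + 0 * a i z < 0 by simpa)
      filter_upwards [this] with ε h1 _ using h1
    · exact Eventually.of_forall fun ε h' => absurd h' (not_lt.2 h)
  filter_upwards [key, self_mem_nhdsWithin] with ε h hε
  have hε : 0 < ε := hε
  constructor
  · intro i hi
    simp only [map_add, map_smul, smul_eq_mul]
    rcases (hy i hi).lt_or_eq with h1 | h1
    · exact (h i hi h1).le
    · have := hz i (mem_activeSet.2 ⟨hi, h1⟩)
      rw [h1]
      nlinarith
  · ext i
    simp only [mem_activeSet, map_add, map_smul, smul_eq_mul]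
    constructor
    · rintro ⟨hi, h0⟩
      rcases (hy i hi).lt_or_eq with h1 | h1
      · exact absurd h0 (h i hi h1).ne
      · rw [h1] at h0
        refine ⟨⟨hi, h1⟩, ?_⟩
        rcases mul_eq_zero.1 ((zero_add _).symm.trans h0) with h2 | h2
        · exact absurd h2 hε.ne'
        · exact h2
    · rintro ⟨⟨hi, h1⟩, h2⟩
      simp [hi, h1, h2]

theorem sum_neg_nonneg (hx : x ∈ ineqCone a T) : 0 ≤ (-∑ i ∈ T, a i) x := by
  simp only [LinearMap.neg_apply, LinearMap.coe_sum, Finset.sum_apply]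
  linarith [Finset.sum_nonpos hx]

theorem sum_neg_pos_iff (hx : x ∈ ineqCone a T) :
    0 < (-∑ i ∈ T, a i) x ↔ x ∉ linealitySpace a T := by
  rw [(sum_neg_nonneg hx).lt_iff_ne', Ne, not_iff_not]
  simp only [LinearMap.neg_apply, LinearMap.coe_sum, Finset.sum_apply, neg_eq_zero]
  exact Finset.sum_eq_zero_iff_of_nonpos hx

variable [AddCommGroup E] [LinearOrder E] [IsOrderedAddMonoid E] [Module ℝ E] [PosSMulMono ℝ E]

/-- A linear programming step: on a slice `f = 1` of a cone, one can move to a vertex (modulo the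
lineality space) without decreasing an objective that is nonpositive on recession directions. -/
theorem exists_vertex {f : V →ₗ[ℝ] ℝ} {l : V →ₗ[ℝ] E}
    (hw : w ∈ ineqCone a T) (hfw : f w = 1)
    (hl : ∀ u ∈ ineqCone a T, u ∈ linealitySpace a (activeSet a T w) → f u = 0 → l u ≤ 0) :
    ∃ y ∈ ineqCone a T, f y = 1 ∧ activeSet a T w ⊆ activeSet a T y ∧ l w ≤ l y ∧
      ∀ u ∈ linealitySpace a (activeSet a T y), f u = 0 → u ∈ linealitySpace a T := by
  classical
  induction hn : (T \ activeSet a T w).card using Nat.strong_induction_on generalizing w with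
  | _ n ih =>
  by_cases hv : ∀ u ∈ linealitySpace a (activeSet a T w), f u = 0 → u ∈ linealitySpace a T
  · exact ⟨w, hw, hfw, subset_rfl, le_rfl, hv⟩
  push Not at hv
  obtain ⟨u, hu, hfu, huT⟩ := hv
  -- One sign of `u` has nonnegative objective. If that direction never leaves the cone, it is a
  -- recession direction, so its objective is zero and the opposite direction can be used.
  have step : ∃ v ∈ linealitySpace a (activeSet a T w), f v = 0 ∧ 0 ≤ l v ∧ ∃ j ∈ T, 0 < a j v := by
    have main : ∀ v ∈ linealitySpace a (activeSet a T w), f v = 0 → v ∉ linealitySpace a T →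
        0 ≤ l v → ∃ v ∈ linealitySpace a (activeSet a T w), f v = 0 ∧ 0 ≤ l v ∧
          ∃ j ∈ T, 0 < a j v := by
      intro v hv hfv hvT hlv
      by_cases hj : ∃ j ∈ T, 0 < a j v
      · exact ⟨v, hv, hfv, hlv, hj⟩
      · push Not at hj
        refine ⟨-v, neg_mem hv, by simp [hfv], ?_, ?_⟩
        · simpa using hl v hj hv hfv
        · rw [mem_linealitySpace] at hvT
          push Not at hvT
          obtain ⟨i, hi, hiv⟩ := hvT
          exact ⟨i, hi, by simpa using lt_of_le_of_ne (hj i hi) hiv⟩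
    rcases le_total 0 (l u) with h | h
    · exact main u hu hfu huT h
    · exact main (-u) (neg_mem hu) (by simp [hfu]) (by simpa using huT) (by simpa using h)
  obtain ⟨v, hv, hfv, hlv, hj⟩ := step
  obtain ⟨t, ht, hmem, hss⟩ := exists_exit hw hv hj
  have hlt : l w ≤ l (w + t • v) := by
    have := smul_nonneg ht hlv
    simpa using this
  obtain ⟨y, hy, hfy, hsub, hly, hver⟩ := ih (T \ activeSet a T (w + t • v)).card (by
      rw [← hn]
      apply Finset.card_lt_card
      obtain ⟨k, hk, hk'⟩ := Finset.exists_of_ssubset hss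
      refine (Finset.ssubset_iff_of_subset (Finset.sdiff_subset_sdiff subset_rfl hss.subset)).2
        ⟨k, ?_, ?_⟩
      · simp [hk', activeSet_subset hk]
      · simp [hk]) hmem (by simp [hfw, hfv])
      (fun u hu hu' => hl u hu (linealitySpace_anti hss.subset hu')) rfl
  exact ⟨y, hy, hfy, hss.subset.trans hsub, hlt.trans hly, hver⟩

variable [FiniteDimensional ℝ V]

theorem finrank_linealitySpace_lt (h : S ⊆ T) (hx : x ∈ linealitySpace a S)
    (hx' : x ∉ linealitySpace a T) :
    Module.finrank ℝ (linealitySpace a T) < Module.finrank ℝ (linealitySpace a S) :=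
  Submodule.finrank_lt_finrank_of_lt <|
    SetLike.lt_iff_le_and_exists.2 ⟨linealitySpace_anti h, x, hx, hx'⟩

/-- Every functional on a cone has a face on which it is nonpositive, and a set of at most as many
constraints as the dimension of this face, tightening which makes the functional nonnegative. -/
theorem exists_face_and_constraints (T : Finset ι) (l : V →ₗ[ℝ] E)
    (hl : ∀ u ∈ linealitySpace a T, l u = 0) :
    ∃ z ∈ ineqCone a T, ∃ I ⊆ T,
      I.card + Module.finrank ℝ (linealitySpace a T) ≤
        Module.finrank ℝ (linealitySpace a (activeSet a T z)) ∧
      (∀ u ∈ ineqCone a T, u ∈ linealitySpace a (activeSet a T z) → l u ≤ 0) ∧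
      (∀ u ∈ ineqCone a T, u ∈ linealitySpace a I → 0 ≤ l u) := by
  classical
  induction T using Finset.strongInduction generalizing l with
  | H T ih =>
  by_cases hpos : ∀ u ∈ ineqCone a T, 0 ≤ l u
  · have h0 : activeSet a T 0 = T := by ext; simp [mem_activeSet]
    exact ⟨0, fun i _ => by simp, ∅, by simp, by rw [h0]; simp,
      fun u _ hu => (hl u (by rwa [h0] at hu)).le, fun u hu _ => hpos u hu⟩
  push Not at hpos
  obtain ⟨x₀, hx₀, hlx₀⟩ := hpos
  -- This `f` is positive on the cone off its lineality space, so the vertices of the slice `f = 1`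
  -- are the extreme rays modulo lineality.
  set f : V →ₗ[ℝ] ℝ := -∑ i ∈ T, a i with hf
  have hfx₀ : 0 < f x₀ := (sum_neg_pos_iff hx₀).2 fun h => hlx₀.ne (hl _ h)
  obtain ⟨x, hx, hfx, -, hlx, hver⟩ := exists_vertex (a := a) (T := T) (f := f) (l := -l)
    (w := (f x₀)⁻¹ • x₀)
    (smul_mem_ineqCone (inv_nonneg.2 hfx₀.le) hx₀) (by simp [hfx₀.ne'])
    (fun u hu _ hfu => by
      have : u ∈ linealitySpace a T := by
        by_contra h
        exact ((sum_neg_pos_iff hu).2 h).ne' hfu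
      simp [hl u this])
  have hlx : l x < 0 := by
    have h1 : l x ≤ (f x₀)⁻¹ • l x₀ := by simpa using hlx
    refine h1.trans_lt (lt_of_le_of_ne (smul_nonpos_of_nonneg_of_nonpos
      (inv_nonneg.2 hfx₀.le) hlx₀.le) ?_)
    simp [hfx₀.ne', hlx₀.ne]
  have hxT : x ∉ linealitySpace a T := fun h => hlx.ne (hl _ h)
  obtain ⟨j, hjT, hj0⟩ : ∃ j ∈ T, a j x ≠ 0 := by
    by_contra! h
    exact hxT h
  have hj : a j x < 0 := lt_of_le_of_ne (hx j hjT) hj0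
  -- Pivot on `j`: `c` is chosen so that `l - a j • c` vanishes at `x`. Since `c ≥ 0` and `a j ≤ 0`
  -- on the cone, the new functional dominates `l` and agrees with it where `j` is tight. Both
  -- properties transfer back, at the cost of one constraint and at least one dimension of
  -- lineality.
  set c : E := (a j x)⁻¹ • l x with hc
  have hc0 : 0 ≤ c := smul_nonneg_of_nonpos_of_nonpos (inv_nonpos.2 hj.le) hlx.le
  set l' : V →ₗ[ℝ] E := l - (a j).smulRight c with hl'
  have hl'_apply : ∀ u, l' u = l u - a j u • c := fun u => by simp [hl']
  have hjx : l' x = 0 := by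
    rw [hl'_apply, hc, smul_inv_smul₀ hj0, sub_self]
  set T' := activeSet a T x with hT'
  have hss : T' ⊂ T := (Finset.ssubset_iff_of_subset activeSet_subset).2
    ⟨j, hjT, fun h => hj0 (mem_activeSet.1 h).2⟩
  obtain ⟨z', hz', I', hI', hcard, hneg, hnn⟩ := ih T' hss l' (fun u hu => by
    have hmem : u - f u • x ∈ linealitySpace a T :=
      hver _ (sub_mem hu (Submodule.smul_mem _ _ mem_linealitySpace_activeSet)) (by simp [hfx])
    have h1 : l' (u - f u • x) = 0 := by rw [hl'_apply, hl _ hmem, hmem j hjT]; simp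
    simpa [hjx] using h1)
  obtain ⟨ε, hz, hact⟩ := (eventually_tangentCone hx hz').exists
  refine ⟨x + ε • z', hz, insert j I', ?_, ?_, ?_, ?_⟩
  · exact Finset.insert_subset hjT (hI'.trans hss.subset)
  · rw [hact, ← hT']
    have h1 := Finset.card_insert_le j I'
    have h2 := finrank_linealitySpace_lt (a := a) hss.subset mem_linealitySpace_activeSet hxT
    omega
  · intro u hu hu'
    rw [hact] at hu'
    have h1 := hneg u (ineqCone_anti hss.subset hu) hu'
    rw [hl'_apply, sub_nonpos] at h1
    exact h1.trans (smul_nonpos_of_nonpos_of_nonneg (hu j hjT) hc0)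
  · intro u hu hu'
    have h1 := hnn u (ineqCone_anti hss.subset hu)
      (linealitySpace_anti (Finset.subset_insert _ _) hu')
    rwa [hl'_apply, hu' j (Finset.mem_insert_self _ _), zero_smul, sub_zero] at h1

end Cones

/-! ### Scalar multiplication on lexicographic orders -/

section Lex

instance Prod.Lex.instPosSMulMono {α β : Type*} [AddCommGroup α] [LinearOrder α] [Module ℝ α]
    [PosSMulMono ℝ α] [AddCommGroup β] [LinearOrder β] [Module ℝ β] [PosSMulMono ℝ β] :
    PosSMulMono ℝ (α ×ₗ β) where
  smul_le_smul_of_nonneg_left c hc x y hxy := by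
    rw [Prod.Lex.le_iff] at hxy ⊢
    simp only [ofLex_smul, Prod.smul_fst, Prod.smul_snd]
    rcases hxy with h | ⟨h, h'⟩
    · rcases (smul_le_smul_of_nonneg_left h.le hc).lt_or_eq with h1 | h1
      · exact Or.inl h1
      · rcases hc.eq_or_lt with rfl | hc
        · simp
        · exact absurd (smul_right_injective α hc.ne' h1) h.ne
    · exact Or.inr ⟨by rw [h], smul_le_smul_of_nonneg_left h' hc⟩

instance Pi.Lex.instPosSMulMono {ι : Type*} [LinearOrder ι] [WellFoundedLT ι] :
    PosSMulMono ℝ (Lex (ι → ℝ)) where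
  smul_le_smul_of_nonneg_left c hc x y hxy := by
    rcases hc.eq_or_lt with rfl | hc
    · simp
    rcases hxy.lt_or_eq with h | rfl
    · obtain ⟨i, h1, h2⟩ := h
      refine le_of_lt ⟨i, fun j hj => ?_, ?_⟩
      · exact congrArg (c * ·) (h1 j hj)
      · exact mul_lt_mul_of_pos_left h2 hc
    · exact le_rfl

end Lex

/-! ### Counting the faces of a cone below a level -/

section FaceComplex

variable {V ι E : Type*} [AddCommGroup V] [Module ℝ V]
  [AddCommGroup E] [LinearOrder E] [Module ℝ E]

open Classical in
/-- The faces of the cone `ineqCone a T`, encoded by their sets of tight constraints, that meet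
`f > 0` and on which `l` is nonpositive. -/
noncomputable def faceComplex (a : ι → V →ₗ[ℝ] ℝ) (T : Finset ι) (f : V →ₗ[ℝ] ℝ)
    (l : V →ₗ[ℝ] E) : Finset (Finset ι) :=
  T.powerset.filter fun S => ∃ y ∈ ineqCone a T, 0 < f y ∧ activeSet a T y = S ∧
    ∀ u ∈ ineqCone a T, u ∈ linealitySpace a S → l u ≤ 0

variable {a : ι → V →ₗ[ℝ] ℝ} {S T : Finset ι} {f : V →ₗ[ℝ] ℝ} {l : V →ₗ[ℝ] E} {y z : V}

theorem mem_faceComplex : S ∈ faceComplex a T f l ↔ ∃ y ∈ ineqCone a T, 0 < f y ∧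
    activeSet a T y = S ∧ ∀ u ∈ ineqCone a T, u ∈ linealitySpace a S → l u ≤ 0 := by
  simp only [faceComplex, Finset.mem_filter, Finset.mem_powerset, and_iff_right_iff_imp]
  rintro ⟨y, -, -, rfl, -⟩
  exact activeSet_subset

theorem eq_zero_of_mem_linealitySpace (hf : ∀ x ∈ ineqCone a T, 0 ≤ f x)
    (hy : y ∈ linealitySpace a T) : f y = 0 :=
  le_antisymm (by simpa using hf _ (linealitySpace_subset_ineqCone (neg_mem hy)))
    (hf _ (linealitySpace_subset_ineqCone hy))

theorem eq_zero_of_mem_faceComplex [IsOrderedAddMonoid E] (hS : S ∈ faceComplex a T f l)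
    (hy : y ∈ linealitySpace a T) : l y = 0 := by
  obtain ⟨x, -, -, rfl, hl⟩ := mem_faceComplex.1 hS
  have h (z) (hz : z ∈ linealitySpace a T) : l z ≤ 0 :=
    hl z (linealitySpace_subset_ineqCone hz) (linealitySpace_anti activeSet_subset hz)
  exact le_antisymm (h y hy) (by simpa using h _ (neg_mem hy))

variable [PosSMulMono ℝ E]

/-- Faces of the tangent cone at `y` along which `l / f` does not exceed its value at `y`
are faces of the complex. -/
theorem activeSet_mem_faceComplex (hf : ∀ x ∈ ineqCone a T, 0 ≤ f x) (hy : y ∈ ineqCone a T)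
    (hfy : f y = 1) (hly : l y ≤ 0) (hz : z ∈ ineqCone a (activeSet a T y))
    (hl : ∀ u ∈ ineqCone a (activeSet a T y),
      u ∈ linealitySpace a (activeSet a (activeSet a T y) z) → l u ≤ f u • l y) :
    activeSet a (activeSet a T y) z ∈ faceComplex a T f l := by
  have hpos : ∀ᶠ ε in nhdsWithin (0 : ℝ) (Set.Ioi 0), 0 < f y + ε * f z := by
    have hc : Filter.Tendsto (fun ε : ℝ => f y + ε * f z) (nhdsWithin 0 (Set.Ioi 0))
        (nhds (f y + 0 * f z)) :=
      (Continuous.tendsto (by fun_prop) 0).mono_left nhdsWithin_le_nhds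
    exact hc.eventually_const_lt (by simp [hfy])
  obtain ⟨ε, ⟨hmem, hact⟩, hε⟩ := ((eventually_tangentCone hy hz).and hpos).exists
  refine mem_faceComplex.2 ⟨_, hmem, by simpa using hε, hact, fun u hu hu' => ?_⟩
  exact (hl u (ineqCone_anti activeSet_subset hu) hu').trans
    (smul_nonpos_of_nonneg_of_nonpos (hf u hu) hly)

variable [IsOrderedAddMonoid E]

/-- On each face of the complex, `l / f` attains its maximum at a vertex. -/
theorem exists_max_vertex (hS : S ∈ faceComplex a T f l) (hf : ∀ x ∈ ineqCone a T, 0 ≤ f x) :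
    ∃ y ∈ ineqCone a T, y ∈ linealitySpace a S ∧ f y = 1 ∧ l y ≤ 0 ∧
      (∀ u ∈ linealitySpace a (activeSet a T y), f u = 0 → u ∈ linealitySpace a T) ∧
      ∀ u ∈ ineqCone a T, u ∈ linealitySpace a S → l u ≤ f u • l y := by
  classical
  have hl0 := fun y => eq_zero_of_mem_faceComplex (y := y) hS
  obtain ⟨x, hx, hfx, rfl, hl⟩ := mem_faceComplex.1 hS
  set A : Set V := {y | y ∈ ineqCone a T ∧ y ∈ linealitySpace a (activeSet a T x) ∧ f y = 1 ∧
    ∀ u ∈ linealitySpace a (activeSet a T y), f u = 0 → u ∈ linealitySpace a T} with hA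
  have hvert : ∀ w ∈ ineqCone a T, w ∈ linealitySpace a (activeSet a T x) → f w = 1 →
      ∃ y ∈ A, l w ≤ l y := by
    intro w hw hw' hfw
    have hsub : activeSet a T x ⊆ activeSet a T w := subset_activeSet activeSet_subset hw'
    obtain ⟨y, hy, hfy, hss, hly, hv⟩ := exists_vertex (l := l) hw hfw
      (fun u hu hu' _ => hl u hu (linealitySpace_anti hsub hu'))
    exact ⟨y, ⟨hy, linealitySpace_anti (hsub.trans hss) mem_linealitySpace_activeSet, hfy, hv⟩, hly⟩
  -- Vertices with the same active set differ by lineality, where `l` vanishes. So `l` takes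
  -- finitely many values on vertices, and a maximum exists without compactness.
  have hval : ∀ y ∈ A, ∀ y' ∈ A, activeSet a T y = activeSet a T y' → l y = l y' := by
    intro y hy y' hy' h
    have h1 : y - y' ∈ linealitySpace a (activeSet a T y) :=
      sub_mem mem_linealitySpace_activeSet (h ▸ mem_linealitySpace_activeSet)
    have h2 := hl0 _ (hy.2.2.2 _ h1 (by simp [hy.2.2.1, hy'.2.2.1]))
    rwa [map_sub, sub_eq_zero] at h2
  have hfin : (l '' A).Finite := by
    have : (activeSet a T '' A).Finite := by
      refine (T.powerset.finite_toSet).subset ?_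
      rintro _ ⟨y, -, rfl⟩
      simpa using activeSet_subset
    obtain ⟨s, hs, hsf⟩ := Set.exists_subset_bijOn A (activeSet a T)
    have hsfin : s.Finite := Set.Finite.of_finite_image (hsf.image_eq ▸ this) hsf.injOn
    refine (hsfin.image l).subset ?_
    rintro _ ⟨y, hy, rfl⟩
    obtain ⟨y', hy', h⟩ := hsf.surjOn (Set.mem_image_of_mem _ hy)
    exact ⟨y', hy', hval _ (hs hy') _ hy h⟩
  have hscale (u) (hu : u ∈ ineqCone a T) (hu' : u ∈ linealitySpace a (activeSet a T x))
      (hfu : 0 < f u) : ∃ y ∈ A, (f u)⁻¹ • l u ≤ l y := by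
    obtain ⟨y, hy, h⟩ := hvert ((f u)⁻¹ • u) (smul_mem_ineqCone (inv_nonneg.2 hfu.le) hu)
      (Submodule.smul_mem _ _ hu') (by simp [hfu.ne'])
    exact ⟨y, hy, by simpa using h⟩
  obtain ⟨y₀, hy₀, -⟩ := hscale x hx mem_linealitySpace_activeSet hfx
  obtain ⟨_, ⟨y, hy, rfl⟩, hmax⟩ := Set.exists_max_image (l '' A) id hfin ⟨_, y₀, hy₀, rfl⟩
  refine ⟨y, hy.1, hy.2.1, hy.2.2.1, hl y hy.1 hy.2.1, hy.2.2.2, fun u hu hu' => ?_⟩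
  rcases (hf u hu).eq_or_lt with h | h
  · rw [← h, zero_smul]
    exact hl u hu hu'
  · obtain ⟨y', hy', h'⟩ := hscale u hu hu' h
    have := smul_le_smul_of_nonneg_left (h'.trans (hmax _ ⟨y', hy', rfl⟩)) h.le
    rwa [smul_inv_smul₀ h.ne'] at this

variable [FiniteDimensional ℝ V]

/-- The maximal vertex of `l / f` on a face of the complex is the minimum of a refinement of
`l / f` to a lexicographic order, subject to few tight constraints. -/
theorem exists_max_vertex_constraints {F : Type*} [AddCommGroup F] [LinearOrder F]
    [IsOrderedAddMonoid F] [Module ℝ F] [PosSMulMono ℝ F] {r : ℕ} {g : V →ₗ[ℝ] F}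
    (hS : S ∈ faceComplex a T f l) (hf : ∀ x ∈ ineqCone a T, 0 ≤ f x)
    (hg : ∀ u ∈ linealitySpace a T, g u = 0)
    (hdim : ∀ S ∈ faceComplex a T f l, Module.finrank ℝ (linealitySpace a S) ≤
      Module.finrank ℝ (linealitySpace a T) + (r + 1)) :
    ∃ y ∈ ineqCone a T, y ∈ linealitySpace a S ∧ f y = 1 ∧ l y ≤ 0 ∧
      (∀ u ∈ ineqCone a T, u ∈ linealitySpace a S → l u ≤ f u • l y) ∧
      ∃ I ⊆ T, I.card ≤ r ∧ y ∈ linealitySpace a I ∧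
        ∀ u ∈ ineqCone a T, u ∈ linealitySpace a I → f u = 1 →
          toLex (l y, g y) ≤ toLex (l u, g u) := by
  have hl0 := fun y => eq_zero_of_mem_faceComplex (y := y) hS
  obtain ⟨y, hy, hyS, hfy, hly, hver, hmax⟩ := exists_max_vertex hS hf
  set L : V →ₗ[ℝ] E ×ₗ F :=
    (toLexLinearEquiv ℝ (E × F)).toLinearMap ∘ₗ l.prod g with hL
  have hLapp (u) : L u = toLex (l u, g u) := rfl
  obtain ⟨z, hz, I, hI, hcard, hneg, hnn⟩ := exists_face_and_constraints (a := a)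
    (activeSet a T y) (L - f.smulRight (L y)) (fun u hu => by
      have h1 : u - f u • y ∈ linealitySpace a T :=
        hver _ (sub_mem hu (Submodule.smul_mem _ _ mem_linealitySpace_activeSet)) (by simp [hfy])
      have h2 : L (u - f u • y) = 0 := by rw [hLapp, hl0 _ h1, hg _ h1]; rfl
      simpa using h2)
  refine ⟨y, hy, hyS, hfy, hly, hmax, I, hI.trans activeSet_subset, ?_,
    linealitySpace_anti hI mem_linealitySpace_activeSet, fun u hu hu' hfu => ?_⟩
  -- The first lexicographic coordinate puts this face in the complex, so `hdim` applies. The bound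
  -- `r` rather than `r + 1` arises because `y` itself adds a dimension to the lineality space of
  -- its tangent cone.
  · have hmem := activeSet_mem_faceComplex hf hy hfy hly hz (fun u hu hu' => by
      have h1 := hneg u hu hu'
      simp only [LinearMap.sub_apply, LinearMap.smulRight_apply, sub_nonpos] at h1
      rcases Prod.Lex.le_iff.1 h1 with h2 | h2
      · exact h2.le
      · exact h2.1.le)
    have h1 := hdim _ hmem
    have h2 := finrank_linealitySpace_lt (a := a) (activeSet_subset (T := T) (x := y))
      mem_linealitySpace_activeSet
      (fun h => by simpa [hfy] using eq_zero_of_mem_linealitySpace hf h)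
    omega
  · have h1 := hnn u (ineqCone_anti activeSet_subset hu) hu'
    simp only [LinearMap.sub_apply, LinearMap.smulRight_apply, sub_nonneg, hfu, one_smul] at h1
    exact h1

/-- The recursive bound on the number of faces of the complex. -/
def faceBound (m : ℕ) : ℕ → ℕ
  | 0 => 0
  | r + 1 => ((r + 1) * m ^ r) * (1 + faceBound m r)

theorem card_powerset_filter_le {m : ℕ} (hm : 1 ≤ m) (T : Finset (Fin m)) (r : ℕ) :
    (T.powerset.filter fun I => I.card ≤ r).card ≤ (r + 1) * m ^ r := by
  have : (T.powerset.filter fun I => I.card ≤ r) ⊆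
      (Finset.range (r + 1)).biUnion fun k => T.powersetCard k := by
    intro I
    simp only [Finset.mem_filter, Finset.mem_powerset, Finset.mem_biUnion, Finset.mem_range,
      Finset.mem_powersetCard]
    rintro ⟨h1, h2⟩
    exact ⟨I.card, by omega, h1, rfl⟩
  refine (Finset.card_le_card this).trans <| (Finset.card_biUnion_le).trans ?_
  refine (Finset.sum_le_card_nsmul _ _ (m ^ r) fun k hk => ?_).trans (by simp)
  rw [Finset.card_powersetCard]
  calc T.card.choose k ≤ m.choose k := Nat.choose_le_choose k (by simpa using T.card_le_univ)
    _ ≤ m ^ k := Nat.choose_le_pow _ _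
    _ ≤ m ^ r := Nat.pow_le_pow_right hm (by simpa [Nat.lt_succ_iff] using hk)

theorem card_faceComplex_le {m : ℕ} (hm : 1 ≤ m) {a : Fin m → V →ₗ[ℝ] ℝ} (r : ℕ)
    {T : Finset (Fin m)} {f : V →ₗ[ℝ] ℝ} {l : V →ₗ[ℝ] E} (hf : ∀ x ∈ ineqCone a T, 0 ≤ f x)
    (hdim : ∀ S ∈ faceComplex a T f l, Module.finrank ℝ (linealitySpace a S) ≤
      Module.finrank ℝ (linealitySpace a T) + r) :
    (faceComplex a T f l).card ≤ faceBound m r := by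
  classical
  induction r generalizing T f l with
  | zero =>
    -- A face meeting `f > 0` is strictly larger than the lineality space, on which `f = 0`.
    rw [faceBound, Nat.le_zero, Finset.card_eq_zero, Finset.eq_empty_iff_forall_notMem]
    intro S hS
    have h := hdim S hS
    obtain ⟨y, hy, hfy, rfl, -⟩ := mem_faceComplex.1 hS
    have := finrank_linealitySpace_lt (a := a) (activeSet_subset (T := T) (x := y))
      mem_linealitySpace_activeSet
      (fun h => hfy.ne' (eq_zero_of_mem_linealitySpace hf h))
    omega
  | succ r ih =>
    -- The tie-break records every constraint value, so equal optima have equal active sets.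
    set g : V →ₗ[ℝ] Lex (Fin m → ℝ) := (toLexLinearEquiv ℝ (Fin m → ℝ)).toLinearMap ∘ₗ
      LinearMap.pi (fun i => if i ∈ T then a i else 0) with hg
    have hgapp (u) (i) : ofLex (g u) i = if i ∈ T then a i u else 0 := by
      change (if i ∈ T then a i else 0) u = _
      split_ifs <;> rfl
    have key (S : Finset (Fin m)) (hS : S ∈ faceComplex a T f l) :=
      exists_max_vertex_constraints (g := g) hS hf (fun u hu => by
        apply ofLex.injective
        funext i
        rw [hgapp]
        split_ifs with h
        · exact hu i h
        · rfl) hdim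
    choose! y hyK hyS hfy hly hmax I hIT hIcard hyI hmin using key
    rw [faceBound, mul_comm]
    refine (Finset.card_le_mul_card_image_of_maps_to (f := I)
      (t := T.powerset.filter fun I => I.card ≤ r)
      (fun S hS => by simpa using ⟨hIT S hS, hIcard S hS⟩) (1 + faceBound m r) ?_).trans
      (Nat.mul_le_mul_left _ (card_powerset_filter_le hm T r))
    intro J _
    rcases ((faceComplex a T f l).filter fun S => I S = J).eq_empty_or_nonempty with h | ⟨S₀, hJ⟩
    · simp [h]
    rw [Finset.mem_filter] at hJ
    obtain ⟨hS₀, rfl⟩ := hJ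
    set p := y S₀ with hp
    set T' := activeSet a T p with hT'
    set f' : V →ₗ[ℝ] ℝ := -∑ i ∈ T', a i with hf'
    set l' : V →ₗ[ℝ] E := l - f.smulRight (l p) with hl'
    have hp1 : f p = 1 := hfy S₀ hS₀
    have hpT : p ∉ linealitySpace a T := fun h => by
      simpa [hp1] using eq_zero_of_mem_linealitySpace hf h
    have hsub : faceComplex a T' f' l' ⊆ faceComplex a T f l := by
      intro S hS
      obtain ⟨z, hz, -, rfl, hl⟩ := mem_faceComplex.1 hS
      refine activeSet_mem_faceComplex hf (hyK S₀ hS₀) hp1 (hly S₀ hS₀) hz fun u hu hu' => ?_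
      simpa [hl'] using hl u hu hu'
    have hcard : (faceComplex a T' f' l').card ≤ faceBound m r := by
      refine ih (fun x hx => sum_neg_nonneg hx) fun S hS => ?_
      have h1 := hdim S (hsub hS)
      have h2 := finrank_linealitySpace_lt (a := a) (activeSet_subset (T := T) (x := p))
        mem_linealitySpace_activeSet hpT
      rw [← hT'] at h2
      omega
    have hcover : ((faceComplex a T f l).filter fun S => I S = I S₀) ⊆
        {T'} ∪ faceComplex a T' f' l' := by
      intro S hS
      obtain ⟨hS, hI⟩ := Finset.mem_filter.1 hS
      -- Each of the two vertices is feasible for the other's minimization problem, as both use the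
      -- same `I`.
      have heq : toLex (l (y S), g (y S)) = toLex (l p, g p) :=
        le_antisymm (hmin S hS p (hyK S₀ hS₀) (hI ▸ hyI S₀ hS₀) hp1)
          (hmin S₀ hS₀ (y S) (hyK S hS) (hI ▸ hyI S hS) (hfy S hS))
      obtain ⟨h1, h2⟩ := Prod.mk.inj (toLex.injective heq)
      have hact : activeSet a T (y S) = T' := by
        ext i
        have := congrFun (congrArg ofLex h2) i
        rw [hgapp, hgapp] at this
        simp only [hT', mem_activeSet, and_congr_right_iff]
        intro hi
        rw [if_pos hi, if_pos hi] at this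
        rw [this]
      rw [Finset.mem_union, Finset.mem_singleton, or_iff_not_imp_left]
      intro hne
      have hSl := hmax S hS
      have hyS' := hyS S hS
      obtain ⟨x, hx, hfx, hxS, hl⟩ := mem_faceComplex.1 hS
      have hST : S ⊆ T' := by
        rw [← hact]
        exact subset_activeSet (hxS ▸ activeSet_subset) hyS'
      have hxT' : activeSet a T' x = S := by
        ext i
        rw [mem_activeSet]
        constructor
        · rintro ⟨h3, h4⟩
          rw [← hxS, mem_activeSet]
          exact ⟨activeSet_subset h3, h4⟩
        · intro h3
          exact ⟨hST h3, (mem_activeSet.1 (hxS ▸ h3)).2⟩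
      have hxK : x ∈ ineqCone a T' := ineqCone_anti activeSet_subset hx
      refine mem_faceComplex.2 ⟨x, hxK, (sum_neg_pos_iff hxK).2 fun h => hne ?_, hxT',
        fun u hu hu' => ?_⟩
      · rw [← hxT']
        exact Finset.Subset.antisymm activeSet_subset (subset_activeSet subset_rfl h)
      -- A short step from `y S` along `u` stays in the face, and maximality of `l / f` at `y S`
      -- gives the inequality for `u`.
      · have hu0 : u ∈ ineqCone a (activeSet a T (y S)) := by rwa [hact]
        obtain ⟨ε, ⟨hmem, -⟩, hε⟩ :=
          ((eventually_tangentCone (hyK S hS) hu0).and self_mem_nhdsWithin).exists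
        have hε : 0 < ε := hε
        have h3 := hSl _ hmem (add_mem hyS' (Submodule.smul_mem _ _ hu'))
        simp only [map_add, map_smul, hfy S hS, add_smul, one_smul, smul_eq_mul, mul_smul,
          add_le_add_iff_left, h1] at h3
        have h4 := smul_le_smul_of_nonneg_left h3 (inv_nonneg.2 hε.le)
        rw [inv_smul_smul₀ hε.ne', inv_smul_smul₀ hε.ne'] at h4
        simpa [hl'] using h4
    calc _ ≤ _ := Finset.card_le_card hcover
      _ ≤ _ := Finset.card_union_le _ _
      _ ≤ _ := by rw [Finset.card_singleton]; omega

/-- Each unfolding adds `d + 1` to the exponent, and d + 1 + d² ≤ (d + 1)². -/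
theorem exists_faceBound_le (d : ℕ) : ∃ C : ℕ, ∀ m, 1 ≤ m → faceBound m (d + 1) ≤ C * m ^ (d ^ 2) := by
  induction d with
  | zero => exact ⟨1, fun m _ => by simp [faceBound]⟩
  | succ d ih =>
    obtain ⟨C, hC⟩ := ih
    refine ⟨(d + 2) * (1 + C), fun m hm => ?_⟩
    have h1 : 1 ≤ m ^ (d ^ 2) := Nat.one_le_pow _ _ hm
    calc faceBound m (d + 1 + 1) = ((d + 2) * m ^ (d + 1)) * (1 + faceBound m (d + 1)) := rfl
      _ ≤ ((d + 2) * m ^ (d + 1)) * ((1 + C) * m ^ (d ^ 2)) := by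
        gcongr
        linarith [hC m hm]
      _ = (d + 2) * (1 + C) * m ^ (d + 1 + d ^ 2) := by ring
      _ ≤ (d + 2) * (1 + C) * m ^ ((d + 1) ^ 2) := by
        gcongr
        nlinarith

end FaceComplex

/-! ### Relative interiors of convex sets -/

section RelativeInterior

variable {W : Type*} [NormedAddCommGroup W] [NormedSpace ℝ W] {P : Set W} {p q : W}

theorem mem_intrinsicInterior_iff_ball : p ∈ intrinsicInterior ℝ P ↔ p ∈ affineSpan ℝ P ∧
    ∃ r > 0, ∀ w ∈ affineSpan ℝ P, dist w p < r → w ∈ P := by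
  rw [mem_intrinsicInterior]
  constructor
  · rintro ⟨y, hy, rfl⟩
    rw [mem_interior_iff_mem_nhds, Metric.mem_nhds_iff] at hy
    obtain ⟨r, hr, h⟩ := hy
    exact ⟨y.2, r, hr, fun w hw hd => h (a := ⟨w, hw⟩) hd⟩
  · rintro ⟨hp, r, hr, h⟩
    refine ⟨⟨p, hp⟩, ?_, rfl⟩
    rw [mem_interior_iff_mem_nhds, Metric.mem_nhds_iff]
    exact ⟨r, hr, fun w hw => h w w.2 hw⟩

/-- The homothety with centre `q` and ratio `1 - s` carries a relative ball about `p` to one about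
the new point, inside `P` by convexity. -/
theorem combo_mem_intrinsicInterior (hP : Convex ℝ P) (hp : p ∈ intrinsicInterior ℝ P)
    (hq : q ∈ P) {s : ℝ} (hs0 : 0 ≤ s) (hs1 : s < 1) :
    AffineMap.lineMap p q s ∈ intrinsicInterior ℝ P := by
  rw [mem_intrinsicInterior_iff_ball] at hp ⊢
  obtain ⟨hp, r, hr, h⟩ := hp
  have hqs : q ∈ affineSpan ℝ P := subset_affineSpan ℝ P hq
  have hs : 0 < 1 - s := by linarith
  refine ⟨AffineMap.lineMap_mem s hp hqs, (1 - s) * r, by positivity, fun w hw hd => ?_⟩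
  set p' := AffineMap.lineMap q w (1 - s)⁻¹ with hp'
  have hw' : w = AffineMap.lineMap p' q s := by
    rw [hp', AffineMap.lineMap_apply_module, AffineMap.lineMap_apply_module]
    match_scalars
    · field_simp
    · field_simp
      ring
  have hdist : dist p' p = (1 - s)⁻¹ * dist w (AffineMap.lineMap p q s) := by
    rw [hw', dist_eq_norm, dist_eq_norm, AffineMap.lineMap_apply_module,
      AffineMap.lineMap_apply_module, add_sub_add_right_eq_sub, ← smul_sub, norm_smul,
      Real.norm_of_nonneg hs.le, inv_mul_cancel_left₀ hs.ne']
  have hmem : p' ∈ P := by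
    refine h p' (AffineMap.lineMap_mem _ hqs hw) ?_
    rw [hdist, inv_mul_lt_iff₀ hs]
    exact hd
  rw [hw']
  exact hP.lineMap_mem hmem hq ⟨hs0, hs1.le⟩

theorem exists_extension_of_mem_intrinsicInterior (hp : p ∈ intrinsicInterior ℝ P) (hq : q ∈ P) :
    ∃ ε > (0 : ℝ), p + ε • (p - q) ∈ P := by
  rw [mem_intrinsicInterior_iff_ball] at hp
  obtain ⟨hp, r, hr, h⟩ := hp
  obtain ⟨ε, hε, hlt⟩ := exists_pos_mul_lt hr ‖p - q‖
  refine ⟨ε, hε, h _ ?_ ?_⟩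
  · have := AffineMap.lineMap_mem (-ε) hp (subset_affineSpan ℝ P hq)
    rw [AffineMap.lineMap_apply_module] at this
    convert this using 1
    module
  · rw [dist_eq_norm, add_sub_cancel_left, norm_smul, Real.norm_of_nonneg hε.le, mul_comm]
    exact hlt

end RelativeInterior

/-! ### Faces of a polyhedron as sets of tight constraints -/

section Polyhedron

open Filter Topology

variable {D n : ℕ} {c : Fin n → EuclideanSpace ℝ (Fin D)} {b : Fin n → ℝ}
  {F : Set (EuclideanSpace ℝ (Fin D))} {x y : EuclideanSpace ℝ (Fin D)}

theorem frontier_halfspace {v : EuclideanSpace ℝ (Fin D)} (hv : v ≠ 0) (r : ℝ) :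
    frontier {x | inner ℝ v x ≤ r} = {x | inner ℝ v x = r} := by
  have hne : innerSL ℝ v ≠ 0 := by
    rwa [Ne, ← norm_eq_zero, innerSL_apply_norm, norm_eq_zero]
  have h := ((innerSL ℝ v).isOpenMap_of_ne_zero hne).preimage_frontier_eq_frontier_preimage
    (innerSL ℝ v).continuous (Set.Iic r)
  rw [frontier_Iic] at h
  exact h.symm

/-- The polyhedron given by a system of linear inequalities. -/
def polyhedron (c : Fin n → EuclideanSpace ℝ (Fin D)) (b : Fin n → ℝ) :
    Set (EuclideanSpace ℝ (Fin D)) := {x | ∀ i, inner ℝ (c i) x ≤ b i}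

/-- The points of the polyhedron at which all constraints tight at `x` are tight. -/
def tightFace (c : Fin n → EuclideanSpace ℝ (Fin D)) (b : Fin n → ℝ)
    (x : EuclideanSpace ℝ (Fin D)) : Set (EuclideanSpace ℝ (Fin D)) :=
  {y | y ∈ polyhedron c b ∧ ∀ i, inner ℝ (c i) x = b i → inner ℝ (c i) y = b i}

theorem convex_polyhedron : Convex ℝ (polyhedron c b) := by
  have : polyhedron c b = ⋂ i, {x | inner ℝ (c i) x ≤ b i} := by
    ext
    simp [polyhedron]
  rw [this]
  exact convex_iInter fun i => convex_halfSpace_le (innerSL ℝ (c i)).isLinear _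

/-- Points sharing the tight constraints of `x` can be reflected through `x` a little. -/
theorem eventually_reflect_mem (hx : x ∈ polyhedron c b) {u : EuclideanSpace ℝ (Fin D)}
    (hu : ∀ i, inner ℝ (c i) x = b i → inner ℝ (c i) u ≤ 0) :
    ∀ᶠ ε in 𝓝[>] (0 : ℝ), x + ε • u ∈ polyhedron c b := by
  have key : ∀ i, ∀ᶠ ε in 𝓝[>] (0 : ℝ), inner ℝ (c i) (x + ε • u) ≤ b i := by
    intro i
    simp only [inner_add_right, inner_smul_right]
    rcases (hx i).lt_or_eq with h | h
    · have hc : Tendsto (fun ε : ℝ => inner ℝ (c i) x + ε * inner ℝ (c i) u) (𝓝[>] 0)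
          (𝓝 (inner ℝ (c i) x + 0 * inner ℝ (c i) u)) :=
        (Continuous.tendsto (by fun_prop) 0).mono_left nhdsWithin_le_nhds
      exact (hc.eventually_lt_const (by simpa)).mono fun _ h => h.le
    · filter_upwards [self_mem_nhdsWithin] with ε hε
      rw [h]
      nlinarith [hu i h, Set.mem_Ioi.1 hε]
  simpa [polyhedron] using eventually_all.2 key

/-- A constraint is tight at a midpoint only if it is tight at both ends, so a minimal tight set is
contained in all the others. -/
theorem exists_minimal_tight (hF : Convex ℝ F) (hne : F.Nonempty) (hFP : F ⊆ polyhedron c b) :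
    ∃ x ∈ F, ∀ y ∈ F, ∀ i, inner ℝ (c i) x = b i → inner ℝ (c i) y = b i := by
  classical
  obtain ⟨x, hx, hmin⟩ := exists_minimalFor_of_wellFoundedLT (· ∈ F)
    (fun x => Finset.univ.filter fun i => inner ℝ (c i) x = b i) hne
  refine ⟨x, hx, fun y hy i hi => ?_⟩
  have hm := hF hx hy (by norm_num : (0 : ℝ) ≤ 1 / 2) (by norm_num : (0 : ℝ) ≤ 1 / 2) (by norm_num)
  have hin : ∀ j, inner ℝ (c j) ((1 / 2 : ℝ) • x + (1 / 2 : ℝ) • y) =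
      1 / 2 * inner ℝ (c j) x + 1 / 2 * inner ℝ (c j) y := by
    simp [inner_add_right, inner_smul_right]
  have h := hmin hm (fun j hj => by
    simp only [Finset.mem_filter, Finset.mem_univ, true_and, hin] at hj ⊢
    linarith [hFP hx j, hFP hy j]) (by simpa using hi : i ∈ _)
  simp only [Finset.mem_filter, Finset.mem_univ, true_and, hin] at h
  linarith

theorem IsPolyhedronFace.exists_eq_tightFace (hF : IsPolyhedronFace (polyhedron c b) F)
    (hne : F.Nonempty) : ∃ x ∈ polyhedron c b, F = tightFace c b x := by
  have hself : ∃ x ∈ polyhedron c b, polyhedron c b = tightFace c b x := by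
    obtain ⟨x, hx, h⟩ := exists_minimal_tight (c := c) (b := b) convex_polyhedron
      (hne.mono (by
        rcases hF with rfl | rfl | ⟨H, -, -, rfl⟩
        · exact subset_rfl
        · exact Set.empty_subset _
        · exact Set.inter_subset_left)) subset_rfl
    exact ⟨x, hx, Set.Subset.antisymm (fun y hy => ⟨hy, h y hy⟩) fun y hy => hy.1⟩
  rcases hF with rfl | rfl | ⟨H, ⟨v, hv, r, rfl⟩, hdisj, rfl⟩
  · exact hself
  · exact absurd hne Set.not_nonempty_empty
  rw [frontier_halfspace hv] at hdisj
  obtain ⟨p, hp⟩ := (hne.mono Set.inter_subset_left).intrinsicInterior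
    (convex_polyhedron (c := c) (b := b))
  have hcross : ∀ q ∈ polyhedron c b, ∀ s : ℝ, 0 ≤ s → s < 1 →
      (1 - s) * inner ℝ v p + s * inner ℝ v q ≠ r := by
    intro q hq s hs0 hs1 h
    refine Set.disjoint_left.1 hdisj ?_ (combo_mem_intrinsicInterior convex_polyhedron hp hq hs0 hs1)
    rw [Set.mem_ofPred_eq, AffineMap.lineMap_apply_module, inner_add_right, inner_smul_right,
      inner_smul_right, h]
  have hpr : inner ℝ v p ≠ r := by
    simpa using hcross p (intrinsicInterior_subset hp) 0 le_rfl one_pos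
  -- A point strictly across the hyperplane from `p` would give a crossing in the relative interior.
  have hside : ∀ q ∈ polyhedron c b, 0 ≤ (inner ℝ v p - r) * (inner ℝ v q - r) := by
    intro q hq
    by_contra! h
    have hd : inner ℝ v p - inner ℝ v q ≠ 0 := by
      intro h0
      have : inner ℝ v q = inner ℝ v p := by linarith
      rw [this] at h
      nlinarith [sq_nonneg (inner ℝ v p - r)]
    refine hcross q hq ((inner ℝ v p - r) / (inner ℝ v p - inner ℝ v q)) ?_ ?_ ?_
    · rcases mul_neg_iff.1 h with h | h
      · exact div_nonneg (by linarith) (by linarith)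
      · exact div_nonneg_of_nonpos (by linarith) (by linarith)
    · rcases mul_neg_iff.1 h with h | h
      · rw [div_lt_one (by linarith)]
        linarith
      · rw [div_lt_one_of_neg (by linarith)]
        linarith
    · field_simp
      ring
  rcases hpr.lt_or_gt with h | h
  · rw [Set.inter_eq_left.2 fun q hq => ?_]
    · exact hself
    · have := hside q hq
      rw [Set.mem_ofPred_eq]
      nlinarith
  -- Here the polyhedron lies where `v` is at least `r`. If `y` shares the tight constraints of `x`,
  -- moving slightly past `x` away from `y` stays in the polyhedron, which forces the value at `y`
  -- to be at most `r`.
  · obtain ⟨x, hx, hmin⟩ := exists_minimal_tight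
      (convex_polyhedron.inter (convex_halfSpace_le (innerSL ℝ v).isLinear r)) hne
      (Set.inter_subset_left (s := polyhedron c b))
    refine ⟨x, hx.1, Set.Subset.antisymm (fun y hy => ⟨hy.1, hmin y hy⟩) fun y hy => ⟨hy.1, ?_⟩⟩
    obtain ⟨ε, hε, hε0⟩ := ((eventually_reflect_mem hx.1 (u := x - y) (fun i hi => by
      rw [inner_sub_right, hi, hy.2 i hi, sub_self])).and self_mem_nhdsWithin).exists
    have h1 := hside _ hε
    have h2 : inner ℝ v x ≤ r := hx.2
    have h0 : 0 < ε := hε0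
    rw [inner_add_right, inner_smul_right, inner_sub_right] at h1
    have h3 := nonneg_of_mul_nonneg_right h1 (by linarith)
    have h4 : 0 ≤ ε * (inner ℝ v x - inner ℝ v y) := by linarith
    have h5 := nonneg_of_mul_nonneg_right h4 h0
    change inner ℝ v y ≤ r
    linarith

/-- The sum of the constraints tight at `x` is maximal exactly on the tight face. A relative
interior point on that hyperplane could be pushed away from a point `q` off the face, exceeding the
maximum. -/
theorem isPolyhedronFace_tightFace :
    IsPolyhedronFace (polyhedron c b) (tightFace c b x) := by
  classical
  set S : Finset (Fin n) := Finset.univ.filter fun i => inner ℝ (c i) x = b i with hS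
  set v := ∑ i ∈ S, c i with hv
  set r := ∑ i ∈ S, b i with hr
  have hxin : inner ℝ v x = r := by
    rw [hv, sum_inner]
    exact Finset.sum_congr rfl fun i hi => (Finset.mem_filter.1 hi).2
  have hle : ∀ y ∈ polyhedron c b, inner ℝ v y ≤ r := by
    intro y hy
    rw [hv, sum_inner]
    exact Finset.sum_le_sum fun i _ => hy i
  have heq : ∀ y ∈ polyhedron c b, inner ℝ v y = r → y ∈ tightFace c b x := by
    intro y hy h
    rw [hv, sum_inner] at h
    refine ⟨hy, fun i hi => ?_⟩
    exact (Finset.sum_eq_sum_iff_of_le fun i _ => hy i).1 h i (by simp [hS, hi])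
  have heq' : ∀ y ∈ tightFace c b x, inner ℝ v y = r := by
    intro y hy
    rw [hv, sum_inner]
    exact Finset.sum_congr rfl fun i hi => hy.2 i (Finset.mem_filter.1 hi).2
  by_cases hP : tightFace c b x = polyhedron c b
  · exact Or.inl hP
  obtain ⟨q, hq, hqF⟩ : ∃ q ∈ polyhedron c b, q ∉ tightFace c b x := by
    by_contra! h
    exact hP (Set.Subset.antisymm (fun y hy => hy.1) h)
  have hv0 : v ≠ 0 := by
    intro h0
    refine hqF (heq q hq ?_)
    rw [h0, inner_zero_left] at hxin ⊢
    exact hxin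
  refine Or.inr (Or.inr ⟨{y | inner ℝ (-v) y ≤ -r}, ⟨-v, neg_ne_zero.2 hv0, -r, rfl⟩, ?_, ?_⟩)
  · rw [frontier_halfspace (neg_ne_zero.2 hv0), Set.disjoint_left]
    intro p hp hpi
    simp only [Set.mem_ofPred_eq, inner_neg_left, neg_inj] at hp
    obtain ⟨ε, hε, hmem⟩ := exists_extension_of_mem_intrinsicInterior hpi hq
    have h1 := hle _ hmem
    rw [inner_add_right, inner_smul_right, inner_sub_right, hp] at h1
    have h2 : inner ℝ v q < r := lt_of_le_of_ne (hle q hq) fun h => hqF (heq q hq h)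
    nlinarith
  · ext y
    simp only [Set.mem_inter_iff, Set.mem_ofPred_eq, inner_neg_left, neg_le_neg_iff]
    exact ⟨fun hy => ⟨hy.1, (heq' y hy).ge⟩, fun hy => heq y hy.1 (le_antisymm (hle y hy.1) hy.2)⟩

end Polyhedron

/-! ### Passing from the polyhedron to the cone over it -/

section Homogenization

open Filter Topology

variable {D n : ℕ} {c : Fin n → EuclideanSpace ℝ (Fin D)} {b : Fin n → ℝ}
  {F : Set (EuclideanSpace ℝ (Fin D))} {x : EuclideanSpace ℝ (Fin D)}
  {ℓ : EuclideanSpace ℝ (Fin D) →ᵃ[ℝ] ℝ} {B : ℝ}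

/-- The constraints of the cone over a polyhedron at height one. -/
noncomputable def homogenize (c : Fin n → EuclideanSpace ℝ (Fin D)) (b : Fin n → ℝ) :
    Fin (n + 1) → EuclideanSpace ℝ (Fin D) × ℝ →ₗ[ℝ] ℝ :=
  Fin.cons (-LinearMap.snd ℝ _ _)
    fun i => innerₗ _ (c i) ∘ₗ LinearMap.fst ℝ _ _ - b i • LinearMap.snd ℝ _ _

@[simp]
theorem homogenize_zero (p : EuclideanSpace ℝ (Fin D) × ℝ) : homogenize c b 0 p = -p.2 := rfl

@[simp]
theorem homogenize_succ (i : Fin n) (p : EuclideanSpace ℝ (Fin D) × ℝ) :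
    homogenize c b i.succ p = inner ℝ (c i) p.1 - b i * p.2 := rfl

theorem mk_one_mem_ineqCone_homogenize :
    (x, (1 : ℝ)) ∈ ineqCone (homogenize c b) Finset.univ ↔ x ∈ polyhedron c b := by
  simp [ineqCone, polyhedron, Fin.forall_fin_succ]

/-- The points of the polyhedron at which the constraints in `S` are tight. -/
def faceOfTight (c : Fin n → EuclideanSpace ℝ (Fin D)) (b : Fin n → ℝ) (S : Finset (Fin (n + 1))) :
    Set (EuclideanSpace ℝ (Fin D)) :=
  {y | y ∈ polyhedron c b ∧ ∀ i : Fin n, i.succ ∈ S → inner ℝ (c i) y = b i}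

theorem succ_mem_activeSet_homogenize {i : Fin n} :
    i.succ ∈ activeSet (homogenize c b) Finset.univ (x, (1 : ℝ)) ↔ inner ℝ (c i) x = b i := by
  simp [mem_activeSet, sub_eq_zero]

theorem zero_notMem_activeSet_homogenize :
    (0 : Fin (n + 1)) ∉ activeSet (homogenize c b) Finset.univ (x, (1 : ℝ)) := by
  simp [mem_activeSet]

theorem faceOfTight_activeSet :
    faceOfTight c b (activeSet (homogenize c b) Finset.univ (x, (1 : ℝ))) = tightFace c b x := by
  ext y
  simp [faceOfTight, tightFace, succ_mem_activeSet_homogenize]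

theorem mem_linealitySpace_homogenize {p : EuclideanSpace ℝ (Fin D) × ℝ} :
    p ∈ linealitySpace (homogenize c b) (activeSet (homogenize c b) Finset.univ (x, (1 : ℝ))) ↔
      ∀ i, inner ℝ (c i) x = b i → inner ℝ (c i) p.1 = b i * p.2 := by
  simp [mem_linealitySpace, Fin.forall_fin_succ, succ_mem_activeSet_homogenize,
    zero_notMem_activeSet_homogenize, sub_eq_zero]

theorem self_mem_tightFace (hx : x ∈ polyhedron c b) : x ∈ tightFace c b x := ⟨hx, fun _ h => h⟩

theorem finrank_linealitySpace_homogenize_le (hx : x ∈ polyhedron c b) :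
    (Module.finrank ℝ (linealitySpace (homogenize c b)
      (activeSet (homogenize c b) Finset.univ (x, (1 : ℝ)))) : ℤ) ≤
      faceDim (tightFace c b x) + 1 := by
  have hne : tightFace c b x ≠ ∅ := (Set.nonempty_of_mem (self_mem_tightFace hx)).ne_empty
  rw [faceDim, if_neg hne]
  set M := (affineSpan ℝ (tightFace c b x)).direction with hM
  set N := linealitySpace (homogenize c b) (activeSet (homogenize c b) Finset.univ (x, (1 : ℝ)))
  have hmem : ∀ p ∈ N, p.1 - p.2 • x ∈ M := by
    intro p hp
    have hp := mem_linealitySpace_homogenize.1 hp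
    have h0 : ∀ i, inner ℝ (c i) x = b i → inner ℝ (c i) (p.1 - p.2 • x) = 0 := by
      intro i hi
      rw [inner_sub_right, inner_smul_right, hi, hp i hi]
      ring
    obtain ⟨ε, hε, hpos⟩ := ((eventually_reflect_mem hx fun i hi => (h0 i hi).le).and
      self_mem_nhdsWithin).exists
    have hpos : 0 < ε := hpos
    have hface : x + ε • (p.1 - p.2 • x) ∈ tightFace c b x := by
      refine ⟨hε, fun i hi => ?_⟩
      rw [inner_add_right, inner_smul_right, h0 i hi, hi]
      simp
    have h1 := AffineSubspace.vsub_mem_direction (subset_affineSpan ℝ _ hface)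
      (subset_affineSpan ℝ _ (self_mem_tightFace hx))
    rw [vsub_eq_sub, add_sub_cancel_left] at h1
    exact (Submodule.smul_mem_iff _ hpos.ne').1 h1
  -- Split off the height: subtracting the multiple of `x` at the same height leaves a direction of
  -- the face.
  set φ : N →ₗ[ℝ] M × ℝ :=
    ((LinearMap.fst ℝ _ ℝ - (LinearMap.snd ℝ _ ℝ).smulRight x).restrict hmem).prod
      (LinearMap.snd ℝ _ ℝ ∘ₗ N.subtype) with hφ
  have hinj : Function.Injective φ := by
    rw [← LinearMap.ker_eq_bot, LinearMap.ker_eq_bot']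
    intro p hp
    have h1 : p.1.1 - p.1.2 • x = 0 := congrArg (fun q => ((q.1 : M) : EuclideanSpace ℝ (Fin D))) hp
    have h2 : p.1.2 = 0 := congrArg Prod.snd hp
    rw [h2, zero_smul, sub_zero] at h1
    exact Subtype.ext (Prod.ext h1 h2)
  have := LinearMap.finrank_le_finrank_of_injective hinj
  rw [Module.finrank_prod, Module.finrank_self] at this
  exact_mod_cast this

/-- The homogenization of `ℓ - B`, refined so that it is nonpositive at height one exactly where
`ℓ < B`. -/
noncomputable def homogenizedObjective (ℓ : EuclideanSpace ℝ (Fin D) →ᵃ[ℝ] ℝ) (B : ℝ) :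
    EuclideanSpace ℝ (Fin D) × ℝ →ₗ[ℝ] ℝ ×ₗ ℝ :=
  (toLexLinearEquiv ℝ (ℝ × ℝ)).toLinearMap ∘ₗ
    (ℓ.linear ∘ₗ LinearMap.fst ℝ _ _ + (ℓ 0 - B) • LinearMap.snd ℝ _ _).prod
      (LinearMap.snd ℝ _ _)

theorem homogenizedObjective_nonpos_iff {p : EuclideanSpace ℝ (Fin D) × ℝ} :
    homogenizedObjective ℓ B p ≤ 0 ↔ ℓ.linear p.1 + (ℓ 0 - B) * p.2 < 0 ∨
      ℓ.linear p.1 + (ℓ 0 - B) * p.2 = 0 ∧ p.2 ≤ 0 :=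
  Prod.Lex.le_iff

theorem apply_eq_linear_add : ℓ x = ℓ.linear x + ℓ 0 := congrFun ℓ.decomp x

/-- The height as second coordinate excludes `ℓ x = B`, turning the strict condition into a weak
lexicographic one. -/
theorem homogenizedObjective_mk_one_nonpos_iff :
    homogenizedObjective ℓ B (x, (1 : ℝ)) ≤ 0 ↔ ℓ x < B := by
  rw [homogenizedObjective_nonpos_iff, apply_eq_linear_add (x := x)]
  constructor
  · rintro (h | ⟨-, h⟩)
    · simp only [mul_one] at h
      linarith
    · exact absurd h (by norm_num)
  · intro h
    left
    simp only [mul_one]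
    linarith

theorem exists_of_mem_faceComplex_homogenize {S : Finset (Fin (n + 1))}
    (hS : S ∈ faceComplex (homogenize c b) Finset.univ (LinearMap.snd ℝ _ ℝ)
      (homogenizedObjective ℓ B)) :
    ∃ x ∈ polyhedron c b, activeSet (homogenize c b) Finset.univ (x, (1 : ℝ)) = S ∧
      tightFace c b x ∈ sublevelComplex (polyhedron c b) ℓ B := by
  obtain ⟨⟨x, t⟩, hx, ht, rfl, hl⟩ := mem_faceComplex.1 hS
  have ht : 0 < t := ht
  have hmk : (t⁻¹ • x, (1 : ℝ)) = t⁻¹ • (x, t) := by simp [ht.ne']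
  have hact : activeSet (homogenize c b) Finset.univ (t⁻¹ • x, (1 : ℝ)) =
      activeSet (homogenize c b) Finset.univ (x, t) := by
    ext i
    rw [hmk]
    simp only [mem_activeSet, map_smul, smul_eq_mul, mul_eq_zero, inv_eq_zero, ht.ne', false_or]
  refine ⟨t⁻¹ • x, ?_, hact, isPolyhedronFace_tightFace, fun y hy => ?_⟩
  · rw [← mk_one_mem_ineqCone_homogenize, hmk]
    exact smul_mem_ineqCone (inv_nonneg.2 ht.le) hx
  · rw [← homogenizedObjective_mk_one_nonpos_iff]
    refine hl _ (mk_one_mem_ineqCone_homogenize.2 hy.1) ?_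
    rw [← hact, mem_linealitySpace_homogenize]
    simpa using hy.2

theorem activeSet_mem_faceComplex_homogenize (hx : x ∈ polyhedron c b)
    (hB : ∀ y ∈ tightFace c b x, ℓ y < B) :
    activeSet (homogenize c b) Finset.univ (x, (1 : ℝ)) ∈
      faceComplex (homogenize c b) Finset.univ (LinearMap.snd ℝ _ ℝ)
        (homogenizedObjective ℓ B) := by
  refine mem_faceComplex.2 ⟨_, mk_one_mem_ineqCone_homogenize.2 hx, by simp, rfl, ?_⟩
  rintro ⟨u, s⟩ hu hu'
  have hs : 0 ≤ s := by simpa using hu 0 (Finset.mem_univ _)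
  have hle : ∀ i, inner ℝ (c i) u ≤ b i * s := fun i => by
    simpa using hu i.succ (Finset.mem_univ _)
  have heq : ∀ i, inner ℝ (c i) x = b i → inner ℝ (c i) u = b i * s :=
    mem_linealitySpace_homogenize.1 hu'
  -- The cone point `(x, 1) + t (u, s)`, rescaled to height one, stays in the face. Large `t` then
  -- shows that the objective at `(u, s)` is nonpositive.
  have hpt : ∀ t : ℝ, 0 ≤ t → (1 + t * s)⁻¹ • (x + t • u) ∈ tightFace c b x := by
    intro t ht
    have h1 : 0 < 1 + t * s := by positivity
    refine ⟨fun i => ?_, fun i hi => ?_⟩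
    · rw [inner_smul_right, inner_add_right, inner_smul_right, inv_mul_le_iff₀ h1]
      nlinarith [hx i, mul_le_mul_of_nonneg_left (hle i) ht]
    · rw [inner_smul_right, inner_add_right, inner_smul_right, inv_mul_eq_iff_eq_mul₀ h1.ne', hi,
        heq i hi]
      ring
  have hbound : ∀ t : ℝ, 0 ≤ t →
      ℓ.linear x + ℓ 0 - B + t * (ℓ.linear u + (ℓ 0 - B) * s) < 0 := by
    intro t ht
    have h1 : 0 < 1 + t * s := by positivity
    have h2 := hB _ (hpt t ht)
    rw [apply_eq_linear_add, map_smul, map_add, map_smul, smul_eq_mul, smul_eq_mul,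
      ← lt_sub_iff_add_lt, inv_mul_lt_iff₀ h1] at h2
    linarith
  rw [homogenizedObjective_nonpos_iff]
  have hnonpos : ℓ.linear u + (ℓ 0 - B) * s ≤ 0 := by
    by_contra! h
    set k := ℓ.linear u + (ℓ 0 - B) * s
    have h1 := hbound (|ℓ.linear x + ℓ 0 - B| / k) (by positivity)
    rw [div_mul_cancel₀ _ h.ne'] at h1
    linarith [neg_abs_le (ℓ.linear x + ℓ 0 - B)]
  rcases hs.eq_or_lt with rfl | hs
  · rcases hnonpos.lt_or_eq with h | h
    · exact Or.inl h
    · exact Or.inr ⟨h, le_rfl⟩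
  -- At positive height, strictness comes from rescaling `(u, s)` itself to a point of the face.
  · left
    have hmem : s⁻¹ • u ∈ tightFace c b x := by
      refine ⟨fun i => ?_, fun i hi => ?_⟩
      · rw [inner_smul_right, inv_mul_le_iff₀ hs, mul_comm]
        exact hle i
      · rw [inner_smul_right, inv_mul_eq_iff_eq_mul₀ hs.ne', mul_comm]
        exact heq i hi
    have h2 := hB _ hmem
    rw [apply_eq_linear_add, map_smul, smul_eq_mul, ← lt_sub_iff_add_lt, inv_mul_lt_iff₀ hs] at h2
    change ℓ.linear u + (ℓ 0 - B) * s < 0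
    linarith

theorem finite_setOf_isPolyhedronFace : {F | IsPolyhedronFace (polyhedron c b) F}.Finite := by
  refine ((Set.finite_range (faceOfTight c b)).insert ∅).subset fun F hF => ?_
  rcases F.eq_empty_or_nonempty with rfl | hne
  · exact Set.mem_insert _ _
  · obtain ⟨x, -, rfl⟩ := IsPolyhedronFace.exists_eq_tightFace hF hne
    exact Set.mem_insert_of_mem _ ⟨_, faceOfTight_activeSet⟩

theorem ncard_sublevelComplex_le {d : ℕ}
    (hdim : ∀ F ∈ sublevelComplex (polyhedron c b) ℓ B, faceDim F ≤ d) :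
    (sublevelComplex (polyhedron c b) ℓ B).ncard ≤ 1 + faceBound (n + 1) (d + 1) := by
  classical
  set C := faceComplex (homogenize c b) Finset.univ (LinearMap.snd ℝ _ ℝ)
    (homogenizedObjective ℓ B) with hC
  have hcard : C.card ≤ faceBound (n + 1) (d + 1) := by
    refine card_faceComplex_le (Nat.le_add_left _ _) (d + 1) (fun p hp => ?_) fun S hS => ?_
    · simpa using hp 0 (Finset.mem_univ _)
    · obtain ⟨x, hx, rfl, hF⟩ := exists_of_mem_faceComplex_homogenize hS
      have h1 := hdim _ hF
      have h2 := finrank_linealitySpace_homogenize_le hx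
      omega
  have hsub : sublevelComplex (polyhedron c b) ℓ B ⊆
      (insert ∅ (C.image (faceOfTight c b)) : Finset (Set (EuclideanSpace ℝ (Fin D)))) := by
    intro F hF
    rw [Finset.coe_insert, Finset.coe_image]
    rcases F.eq_empty_or_nonempty with rfl | hne
    · exact Set.mem_insert _ _
    · obtain ⟨x, hx, rfl⟩ := hF.1.exists_eq_tightFace hne
      exact Set.mem_insert_of_mem _
        ⟨_, activeSet_mem_faceComplex_homogenize hx hF.2, faceOfTight_activeSet⟩
  have h1 := Set.ncard_le_ncard hsub (Finset.finite_toSet _)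
  rw [Set.ncard_coe_finset] at h1
  have h2 := Finset.card_insert_le (∅ : Set (EuclideanSpace ℝ (Fin D)))
    (C.image (faceOfTight c b))
  have h3 := Finset.card_image_le (s := C) (f := faceOfTight c b)
  omega

/-- If `ℓ` attains a minimum, the faces on which `ℓ` is bounded are the faces on which `ℓ` is less
than a large enough bound. -/
theorem exists_sublevelComplex_top_eq
    (hmin : ∃ x ∈ polyhedron c b, IsMinOn ℓ (polyhedron c b) x) :
    ∃ B : ℝ, sublevelComplex (polyhedron c b) ℓ ⊤ = sublevelComplex (polyhedron c b) ℓ B := by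
  obtain ⟨x₀, -, hx₀⟩ := hmin
  have hfin : (sublevelComplex (polyhedron c b) ℓ ⊤).Finite :=
    finite_setOf_isPolyhedronFace.subset fun F hF => hF.1
  have hbdd : BddAbove (⋃ F ∈ sublevelComplex (polyhedron c b) ℓ ⊤, ℓ '' F) :=
    hfin.bddAbove_biUnion.2 fun F hF => hF.2.1
  obtain ⟨B, hB⟩ := hbdd
  refine ⟨B + 1, Set.Subset.antisymm (fun F hF => ⟨hF.1, fun x hx => ?_⟩) fun F hF =>
    ⟨hF.1, ⟨B + 1, ?_⟩, ⟨ℓ x₀, ?_⟩⟩⟩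
  · have := hB (Set.mem_biUnion hF (Set.mem_image_of_mem ℓ hx))
    linarith
  · rintro _ ⟨x, hx, rfl⟩
    exact (hF.2 x hx).le
  · rintro _ ⟨x, hx, rfl⟩
    refine hx₀ ?_
    rcases hF.1 with rfl | rfl | ⟨H, -, -, rfl⟩
    · exact hx
    · exact absurd hx (Set.notMem_empty x)
    · exact hx.1

end Homogenization

/-! ### The bound for the polyhedron -/

theorem mainTheorem3 (d : ℤ) :
    ∃ C : ℝ, ∀ (D n : ℕ), 1 ≤ n →
      ∀ H : Fin n → Set (EuclideanSpace ℝ (Fin D)), (∀ i, IsClosedHalfspace (H i)) →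
      ∀ P : Set (EuclideanSpace ℝ (Fin D)), P = ⋂ i, H i →
      ∀ ℓ : EuclideanSpace ℝ (Fin D) →ᵃ[ℝ] ℝ, (∃ x ∈ P, IsMinOn ℓ P x) →
      ∀ B : WithTop ℝ, SublevelComplexHasDim P ℓ B d → d < (D : ℤ) →
        (sublevelComplex P ℓ B).Finite ∧
          ((sublevelComplex P ℓ B).ncard : ℝ) ≤ C * (n : ℝ) ^ (d ^ 2) := by
  obtain ⟨C, hC⟩ := exists_faceBound_le d.toNat
  refine ⟨1 + C * 2 ^ (d.toNat ^ 2), ?_⟩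
  intro D n hn H hH P hP ℓ hmin B hdim _
  choose c _ b hcb using hH
  obtain rfl : P = polyhedron c b := by
    rw [hP]
    ext x
    simp [hcb, polyhedron]
  have hfin : (sublevelComplex (polyhedron c b) ℓ B).Finite :=
    finite_setOf_isPolyhedronFace.subset fun F hF => by
      cases B <;> exact hF.1
  refine ⟨hfin, ?_⟩
  have hle : ∀ F ∈ sublevelComplex (polyhedron c b) ℓ B, faceDim F ≤ d :=
    fun F hF => hdim.2 ⟨F, hF, rfl⟩
  have hn1 : (1 : ℝ) ≤ n := by exact_mod_cast hn
  -- For negative `d` only the empty face can occur.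
  rcases lt_or_ge d 0 with hd | hd
  · have hsub : sublevelComplex (polyhedron c b) ℓ B ⊆ {∅} := by
      intro F hF
      by_contra hne
      have := hle F hF
      rw [faceDim, if_neg (show F ≠ ∅ from hne)] at this
      omega
    have h1 : (sublevelComplex (polyhedron c b) ℓ B).ncard ≤ 1 :=
      (Set.ncard_le_ncard hsub).trans (Set.ncard_singleton _).le
    have h2 : (1 : ℝ) ≤ (n : ℝ) ^ (d ^ 2) := one_le_zpow₀ hn1 (sq_nonneg d)
    have h3 : (1 : ℝ) ≤ 1 + C * 2 ^ (d.toNat ^ 2) := by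
      have : (0 : ℝ) ≤ C * 2 ^ (d.toNat ^ 2) := by positivity
      linarith
    calc ((sublevelComplex (polyhedron c b) ℓ B).ncard : ℝ) ≤ 1 := by exact_mod_cast h1
      _ ≤ _ := one_le_mul_of_one_le_of_one_le h3 h2
  lift d to ℕ using hd
  obtain ⟨B', hB'⟩ : ∃ B' : ℝ, sublevelComplex (polyhedron c b) ℓ B =
      sublevelComplex (polyhedron c b) ℓ B' := by
    cases B with
    | top => exact exists_sublevelComplex_top_eq hmin
    | coe B => exact ⟨B, rfl⟩
  rw [hB'] at hle ⊢
  have h1 := ncard_sublevelComplex_le hle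
  rw [Int.toNat_natCast] at hC ⊢
  -- The leading 1 counts the empty face. The height constraint makes `n + 1` constraints, and n + 1
  -- ≤ 2n gives the factor 2^{d²}.
  have h2 : 1 + faceBound (n + 1) (d + 1) ≤ (1 + C * 2 ^ (d ^ 2)) * n ^ (d ^ 2) := by
    calc 1 + faceBound (n + 1) (d + 1) ≤ n ^ (d ^ 2) + C * (n + 1) ^ (d ^ 2) :=
          add_le_add (Nat.one_le_pow _ _ hn) (hC _ (Nat.le_add_left _ _))
      _ ≤ n ^ (d ^ 2) + C * (2 * n) ^ (d ^ 2) := by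
          gcongr
          omega
      _ = _ := by rw [mul_pow]; ring
  have h3 : (n : ℝ) ^ ((d : ℤ) ^ 2) = (n : ℝ) ^ (d ^ 2) := by
    rw [← zpow_natCast]
    norm_cast
  rw [h3]
  exact_mod_cast h1.trans h2
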